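/- Conventions. For sets $A,B$ write $A\subseteq^* B$ if $A\setminus B$ is finite, and call $A,B$ almost disjoint if $A\cap B$ is finite. A tower (of height $\omega_1$) is a sequence $T=\langle T_\alpha:\alpha<\omega_1\rangle$ of subsets of $\omega$ with $T_\beta\subseteq^* T_\alpha$ for $\beta<\alpha$; it is strictly increasing if moreover $T_\alpha\setminus T_\beta$ is infinite for all $\beta<\alpha$. A subtower of $T$ is a tower $S$ with $S_\alpha\subseteq T_\alpha$ for all $\alpha$ and $S_\alpha\cap(T_\beta\setminus S_\beta)$ finite for all $\beta<\alpha$. A subtower $A$ of $T$ is a gap in $T$ if $\langle A_\alpha\rangle$ and $\langle T_\alpha\setminus A_\alpha\rangle$ form a Hausdorff gap, i.e. they are towers, levelwise almost disjoint, and there is no $X\subseteq\omega$ such that, for all $\alpha$, $A_\alpha\subseteq^* X$ and $X$ is almost disjoint from $T_\alpha\setminus A_\alpha$. Two gaps $A,A'$ in $T$ are cohomologous if $\langle A_\alpha\mathbin{\triangle}A'_\alpha:\alpha<\omega_1\rangle$ is not a gap in $T$. Let $\mathcal D$ be the family of all $D\subseteq\omega$ such that $D\supseteq T_\alpha$ and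 $D\setminus T_\alpha$ is finite for some $\alpha<\omega_1$. For $D\in\mathcal D$ let $F_D=\bigoplus_D\mathbb Z/2$ be the group of finitely supported functions $D\to\mathbb Z/2$, with the restriction maps $F_D\to F_E$ for $E\subseteq D$. Let $C^n(\mathcal D,F)=\prod_{D_0\supseteq\dots\supseteq D_n,\ D_i\in\mathcal D}F_{D_n}$, with coboundary $$(\delta x)(D_0,\dots,D_{n+1})=\sum_{i=0}^{n}(-1)^i x(D_0,\dots,\widehat{D_i},\dots,D_{n+1})+(-1)^{n+1}x(D_0,\dots,D_n)\restriction D_{n+1}.$$ The gap cohomology group of $T$ is $H^1(\mathcal D,F)$, the kernel of $\delta:C^1\to C^2$ modulo the image of $\delta:C^0\to C^1$. Statement. Let $T=\langle T_\alpha:\alpha<\omega_1\rangle$ be a strictly increasing tower. Then: (i) The gap cohomology group of $T$ has cardinality at least $2^{\aleph_0}$. (ii) There is a matrix $\langle A(m,\alpha):m\in\omega,\alpha<\omega_1\rangle$ of subsets of $\omega$ with the following properties: (1) for each $m$, $\langle A(m,\alpha):\alpha<\omega_1\rangle$ is a subtower of $T$; (2) for all $m_0<m_1$, all $\alpha<\omega_1$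 and all $r\in\omega$, the set $\{\beta<\alpha: A(m_0,\alpha)\cap A(m_1,\beta)\subseteq\{0,\dots,r-1\}\}$ is finite; (3) for all $\beta<\alpha<\omega_1$ there is $m_0$ such that $A(m,\alpha)\cap T_\beta=A(m,\beta)$ for all $m>m_0$; (4) for each $\alpha<\omega_1$, $T_\alpha$ is the disjoint union of the sets $A(m,\alpha)$, $m\in\omega$. (iii) Let $\langle A(m,\alpha)\rangle$ be any matrix satisfying (1)-(4), and for $X\subseteq\omega$ let $A(X)=\langle\bigcup_{m\in X}A(m,\alpha):\alpha<\omega_1\rangle$. If $X\ne\emptyset,\omega$, then $A(X)$ is a gap in $T$. If $X,Y\subseteq\omega$ are both different from $\emptyset$ and $\omega$, $X\ne Y$ and $Y\ne\omega\setminus X$, then the gaps $A(X)$ and $A(Y)$ are not cohomologous. -/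

import Mathlib

open scoped Cardinal symmDiff

/-- The set `ω₁` of countable ordinals, with its usual order. -/
abbrev OmegaOne : Type 1 := Set.Iio (Ordinal.omega.{0} 1)

/-- Almost inclusion `A ⊆* B`: the difference `A \ B` is finite. -/
def AlmostSubset (A B : Set ℕ) : Prop := (A \ B).Finite

/-- `A ⊊* B` (`B` is strictly above `A`): `A \ B` is finite and `B \ A` is infinite. -/
def StrictlyBelow (A B : Set ℕ) : Prop := AlmostSubset A B ∧ (B \ A).Infinite

/-- A tower of height `ω₁` in `𝒫(ω)`: an `ω₁`-sequence of sets increasing modulo finite. -/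
def IsTower (T : OmegaOne → Set ℕ) : Prop :=
  ∀ β α, β < α → AlmostSubset (T β) (T α)

/-- A tower of height `ω₁` that is strictly increasing modulo finite. -/
def IsStrictTower (T : OmegaOne → Set ℕ) : Prop :=
  ∀ β α, β < α → StrictlyBelow (T β) (T α)

/-- `S` is a subtower of `T`: a tower, levelwise included in `T`, whose restriction to lower
levels of `T` is faithful modulo finite. -/
def IsSubtower (S T : OmegaOne → Set ℕ) : Prop :=
  IsTower S ∧ (∀ α, S α ⊆ T α) ∧ ∀ β α, β < α → (S α ∩ (T β \ S β)).Finite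

/-- A pregap: a pair of towers of height `ω₁` which are levelwise almost disjoint. -/
def IsPregap (A B : OmegaOne → Set ℕ) : Prop :=
  IsTower A ∧ IsTower B ∧ ∀ α, (A α ∩ B α).Finite

/-- A Hausdorff gap: a pregap that no `X ⊆ ω` separates. -/
def IsHausdorffGap (A B : OmegaOne → Set ℕ) : Prop :=
  IsPregap A B ∧ ¬ ∃ X : Set ℕ, ∀ α, AlmostSubset (A α) X ∧ (X ∩ B α).Finite

/-- `A` is a gap in `T`: `A` is a subtower of `T` which forms a Hausdorff gap together with its
levelwise complement in `T`. -/
def IsGapIn (A T : OmegaOne → Set ℕ) : Prop :=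
  IsSubtower A T ∧ IsHausdorffGap A (fun α => T α \ A α)

/-- For two gaps `A`, `A'` in `T`: they are cohomologous if their levelwise symmetric difference
is not a gap in `T`. -/
def Cohomologous (T A A' : OmegaOne → Set ℕ) : Prop :=
  ¬ IsGapIn (fun α => A α ∆ A' α) T

/-- The closure of the levels of `T` under finite upward modification. -/
def upwardFamily (T : OmegaOne → Set ℕ) : Set (Set ℕ) :=
  {D | ∃ α, T α ⊆ D ∧ (D \ T α).Finite}

/-- The coefficient group `F_D = ⨁_D ℤ/2` of finitely supported functions from `D` to `ℤ/2`. -/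
abbrev FinCoeff (D : Set ℕ) : Type := D →₀ ZMod 2

/-- The restriction map `F_D → F_E`, for `E ⊆ D`. -/
noncomputable def FinCoeff.restrict {D E : Set ℕ} (h : E ⊆ D) : FinCoeff D →+ FinCoeff E :=
  Finsupp.comapDomain.addMonoidHom (Set.inclusion_injective h)

/-- The chains `D₀ ⊇ D₁ ⊇ … ⊇ Dₙ` of members of the family `𝒟`. -/
structure DescChain (𝒟 : Set (Set ℕ)) (n : ℕ) where
  /-- the sets of the chain -/
  sets : Fin (n + 1) → Set ℕ
  mem : ∀ i, sets i ∈ 𝒟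
  desc : Antitone sets

/-- The smallest member `Dₙ` of a chain `D₀ ⊇ … ⊇ Dₙ`. -/
def DescChain.smallest {𝒟 : Set (Set ℕ)} {n : ℕ} (c : DescChain 𝒟 n) : Set ℕ :=
  c.sets (Fin.last n)

/-- The chain obtained by removing `Dᵢ`. -/
def DescChain.face {𝒟 : Set (Set ℕ)} {n : ℕ} (c : DescChain 𝒟 (n + 1)) (i : Fin (n + 2)) :
    DescChain 𝒟 n where
  sets j := c.sets (i.succAbove j)
  mem _ := c.mem _
  desc := c.desc.comp_monotone (Fin.strictMono_succAbove i).monotone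

theorem DescChain.smallest_subset_face {𝒟 : Set (Set ℕ)} {n : ℕ} (c : DescChain 𝒟 (n + 1))
    (i : Fin (n + 2)) : c.smallest ⊆ (c.face i).smallest :=
  c.desc (Fin.le_last _)

/-- The group of `n`-cochains `Cⁿ(𝒟, F) = ∏_{D₀ ⊇ … ⊇ Dₙ} F_{Dₙ}`. -/
abbrev Cochain (𝒟 : Set (Set ℕ)) (n : ℕ) : Type :=
  ∀ c : DescChain 𝒟 n, FinCoeff c.smallest

/-- The coboundary operator
`(δx)(D₀ ⊇ … ⊇ Dₙ₊₁) = ∑ᵢ (-1)ⁱ x(D₀ … D̂ᵢ … Dₙ₊₁)`, where every term is restricted to `Dₙ₊₁`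
(only the last term is really restricted: for `i ≤ n` the smallest member is already `Dₙ₊₁`). -/
noncomputable def coboundary (𝒟 : Set (Set ℕ)) (n : ℕ) : Cochain 𝒟 n →+ Cochain 𝒟 (n + 1) where
  toFun x c := ∑ i : Fin (n + 2),
    (-1 : ℤ) ^ (i : ℕ) • FinCoeff.restrict (c.smallest_subset_face i) (x (c.face i))
  map_zero' := by
    funext c
    simp
  map_add' x y := by
    funext c
    simp [Finset.sum_add_distrib]

/-- The first cohomology group `H¹(𝒟, F)`: the 1-cocycles modulo the 1-coboundaries. -/
abbrev FirstCohomology (𝒟 : Set (Set ℕ)) : Type :=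
  (coboundary 𝒟 1).ker ⧸ ((coboundary 𝒟 0).range.addSubgroupOf (coboundary 𝒟 1).ker)

/-- The gap cohomology group of the tower `T`. -/
abbrev GapCohomology (T : OmegaOne → Set ℕ) : Type :=
  FirstCohomology (upwardFamily T)

/-- The `ω × ω₁` matrices of simultaneous subtowers ("columns") of `T`: each column is a subtower
of `T`, any two columns intersect as much as in a Hausdorff gap, all but finitely many columns
restrict exactly from one level to a lower one, and each level of `T` is the disjoint union of the
corresponding row. -/
structure IsGapMatrix (T : OmegaOne → Set ℕ) (A : ℕ → OmegaOne → Set ℕ) : Prop where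
  subtower : ∀ m, IsSubtower (A m) T
  meet : ∀ m₀ m₁, m₀ < m₁ → ∀ (α : OmegaOne) (r : ℕ),
    {β | β < α ∧ A m₀ α ∩ A m₁ β ⊆ Set.Iio r}.Finite
  coherent : ∀ α β, β < α → ∃ m₀, ∀ m, m₀ < m → A m α ∩ T β = A m β
  union : ∀ α, T α = ⋃ m, A m α
  disjoint : ∀ α m m', m ≠ m' → Disjoint (A m α) (A m' α)

/-- The levelwise union `A(X)` of the columns of the matrix `A` indexed by `X`. -/
def columnUnion (A : ℕ → OmegaOne → Set ℕ) (X : Set ℕ) : OmegaOne → Set ℕ :=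
  fun α => ⋃ m ∈ X, A m α

/-!
A gap matrix is the same thing as a family of colourings `f α : T α → ω`, `α < ω₁`, with
`A m α = {n ∈ T α | f α n = m}`: that the columns are subtowers which cohere says exactly that `f α`
and `f β` agree on `T β` modulo finite for `β < α`. There remains Hausdorff's condition: for
`m₀ < m₁` and `r`, only finitely many `β < α` have no `n ≥ r` with `f α n = m₀` and `f β n = m₁`.

*Existence.* The colourings are built by recursion on `α` (`exists_forall_extends`), with the
additional requirement that every colour occurs infinitely often in `T α \ T β`. Level `α` is reached
along a cofinal sequence `a 0 ≤ a 1 ≤ …` below `α` (`exists_extends`). A colouring `g k` on a set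
`=* T (a k)` is extended to `g (k + 1)` on a set `=* T (a (k + 1))` in such a way that every
`β ∈ (a k, a (k + 1)]` obtains, for all `m₀ < m₁ ≤ k`, a witness `n ≥ k` for Hausdorff's condition
(`exists_ladder_step`). By Hausdorff's condition at `a (k + 1)` only finitely many `β` lack a witness,
and these are provided by recolouring finitely many points outside the domain of `g k`. Recolouring
always lowers colours, and pairs are treated in the order of increasing `m₁`; hence no earlier
witness is lost (`exists_recolor_forall`).

*Gaps.* A set `Z` separating the columns `m₀ < m₁` does so above a bound `r α` at each level. Some
`α` shares its bound with infinitely many `β < α`, against Hausdorff's condition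
(`IsGapMatrix.not_separated`). So `A(X)` is a gap for `X ≠ ∅, ω`. As `A(X) ∆ A(Y) = A(X ∆ Y)`, the
gaps `A(X)` and `A(Y)` are not cohomologous unless `Y` is `X` or its complement.

*Cohomology.* The indicator functions `a D` of `A(X)` on the sets `D ∈ 𝒟` form a coherent family, and
`a E - a D ↾ E` is a 1-cocycle. If the cocycles of `X` and `Y` differ by the coboundary of `y`, then
subtracting `y D` from the difference of the indicators leaves functions that are restrictions of one
another. Since `𝒟` is directed, they glue to a subset of `ω`
(`IsCoherentFamily.exists_set_of_cohomologyClass_eq`), and it separates `A(X ∆ Y)` from its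
complement in `T`. Letting `X` range over the sets containing `0`, where no two are complementary,
gives continuum many classes.
-/

/-! ### Equality modulo finite -/

/-- `f` and `g` agree at all but finitely many points of `S`. -/
def EqModFinOn (S : Set ℕ) (f g : ℕ → ℕ) : Prop := {n ∈ S | f n ≠ g n}.Finite

theorem AlmostSubset.trans {A B C : Set ℕ} (h₁ : AlmostSubset A B) (h₂ : AlmostSubset B C) :
    AlmostSubset A C :=
  (h₁.union h₂).subset fun n hn => by
    by_cases hB : n ∈ B
    · exact Or.inr ⟨hB, hn.2⟩
    · exact Or.inl ⟨hn.1, hB⟩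

namespace EqModFinOn

variable {S S' : Set ℕ} {f g h : ℕ → ℕ}

theorem refl (S : Set ℕ) (f : ℕ → ℕ) : EqModFinOn S f f := by simp [EqModFinOn]

theorem symm (hfg : EqModFinOn S f g) : EqModFinOn S g f :=
  hfg.subset fun _ hn => ⟨hn.1, hn.2.symm⟩

theorem trans (hfg : EqModFinOn S f g) (hgh : EqModFinOn S g h) : EqModFinOn S f h :=
  (hfg.union hgh).subset fun n hn => by
    by_cases hn' : f n = g n
    · exact Or.inr ⟨hn.1, fun e => hn.2 (hn'.trans e)⟩
    · exact Or.inl ⟨hn.1, hn'⟩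

theorem mono (hS : AlmostSubset S' S) (hfg : EqModFinOn S f g) : EqModFinOn S' f g :=
  (hS.union hfg).subset fun n hn => by
    by_cases hn' : n ∈ S
    · exact Or.inr ⟨hn', hn.2⟩
    · exact Or.inl ⟨hn.1, hn'⟩

end EqModFinOn

theorem Set.Finite.exists_forall_lt_nat {s : Set ℕ} (hs : s.Finite) : ∃ R, ∀ n ∈ s, n < R := by
  obtain ⟨R, hR⟩ := hs.bddAbove
  exact ⟨R + 1, fun n hn => Nat.lt_succ_of_le (hR hn)⟩

/-! ### Recolouring finitely many points -/

/-- Finitely many infinite sets `W i` of points of colour `M` are given; each of them can be made to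
contain a point of a prescribed smaller colour `c i` by recolouring finitely many points. -/
theorem exists_recolor {κ : Type*} (h : ℕ → ℕ) (M : ℕ) (W : κ → Set ℕ) (c : κ → ℕ)
    (E : Finset κ) (hW : ∀ i ∈ E, (W i).Infinite) (hM : ∀ i ∈ E, ∀ n ∈ W i, h n = M)
    (hc : ∀ i ∈ E, c i < M) :
    ∃ h' : ℕ → ℕ, {n | h' n ≠ h n}.Finite ∧ (∀ n, h' n ≠ h n → ∃ i ∈ E, n ∈ W i) ∧
      ∀ i ∈ E, ∃ n ∈ W i, h' n = c i := by
  classical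
  induction E using Finset.induction_on with
  | empty => exact ⟨h, by simp⟩
  | insert i E hi ih =>
    obtain ⟨h', hfin, hne, hwit⟩ := ih (fun j hj => hW j (Finset.mem_insert_of_mem hj))
      (fun j hj => hM j (Finset.mem_insert_of_mem hj))
      (fun j hj => hc j (Finset.mem_insert_of_mem hj))
    obtain ⟨n, hn, hn'⟩ := ((hW i (Finset.mem_insert_self i E)).sdiff hfin).nonempty
    have hn'' : h' n = M := by
      have : h' n = h n := by simpa using hn'
      rw [this, hM i (Finset.mem_insert_self i E) n hn]
    refine ⟨Function.update h' n (c i), (hfin.insert n).subset fun k hk => ?_, fun k hk => ?_,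
      fun j hj => ?_⟩
    · by_cases hkn : k = n
      · exact Or.inl hkn
      · exact Or.inr (by simpa [Function.update_of_ne hkn] using hk)
    · by_cases hkn : k = n
      · exact ⟨i, Finset.mem_insert_self i E, hkn ▸ hn⟩
      · obtain ⟨j, hj, hkj⟩ := hne k (by simpa [Function.update_of_ne hkn] using hk)
        exact ⟨j, Finset.mem_insert_of_mem hj, hkj⟩
    · rcases Finset.mem_insert.1 hj with rfl | hjE
      · exact ⟨n, hn, by simp⟩
      · obtain ⟨k, hk, hkc⟩ := hwit j hjE
        have hkn : k ≠ n := by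
          rintro rfl
          have := hc j hj
          omega
        exact ⟨k, hk, by rw [Function.update_of_ne hkn, hkc]⟩

/-- `C β m` is the set of points to which the `β`-th colouring gives colour `m`. If all but finitely
many `β ∈ B` already meet the colouring `h` in Hausdorff's sense, then a finite modification of `h`
outside `U` produces witnesses above `K` for *all* `β ∈ B` and all pairs of colours `≤ M`.

The pairs `m₀ < m₁` are treated in the order of increasing `m₁`: a recoloured point passes from
`m₁` to `m₀ < m₁`, so it was not a witness for any pair treated before. -/
theorem exists_recolor_forall {ι : Type*} (B : Set ι) (C : ι → ℕ → Set ℕ) (U : Set ℕ) (K : ℕ)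
    (h : ℕ → ℕ)
    (hfin : ∀ m₀ m₁, m₀ < m₁ → ∀ r,
      {β ∈ B | ∀ n ∈ C β m₁, h n = m₀ → n < r}.Finite)
    (hinf : ∀ β ∈ B, ∀ m, {n ∈ C β m | h n = m ∧ n ∉ U}.Infinite) (M : ℕ) :
    ∃ h' : ℕ → ℕ, {n | h' n ≠ h n}.Finite ∧ (∀ n ∈ U, h' n = h n) ∧
      ∀ β ∈ B, ∀ m₀ m₁, m₀ < m₁ → m₁ ≤ M → ∃ n ∈ C β m₁, K ≤ n ∧ h' n = m₀ := by
  induction M with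
  | zero => exact ⟨h, by simp, by simp, fun β _ m₀ m₁ h₁ h₂ => by omega⟩
  | succ M ih =>
    obtain ⟨h', hh', hU, hwit⟩ := ih
    obtain ⟨R, hR⟩ := hh'.exists_forall_lt_nat
    -- the indices for which a witness for some pair `(m₀, M + 1)` is missing
    let E : Set ι := ⋃ m₀ ∈ Finset.range (M + 1),
      {β ∈ B | ∀ n ∈ C β (M + 1), h' n = m₀ → n < K}
    have hE : E.Finite := by
      refine Set.Finite.biUnion (Finset.finite_toSet _) fun m₀ hm₀ => ?_
      have hm : m₀ < M + 1 := by simpa using hm₀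
      refine (hfin m₀ (M + 1) hm (max R K)).subset fun β hβ => ⟨hβ.1, fun n hn hnm => ?_⟩
      by_cases hne : h' n = h n
      · exact lt_max_of_lt_right (hβ.2 n hn (hne.trans hnm))
      · exact lt_max_of_lt_left (hR n hne)
    have hEB : ∀ β ∈ E, β ∈ B := by
      intro β hβ
      simp only [E, Set.mem_iUnion] at hβ
      obtain ⟨_, _, h⟩ := hβ
      exact h.1
    obtain ⟨h'', hh'', hne, hwit'⟩ := exists_recolor h' (M + 1)
      (fun p : ι × ℕ => {n ∈ C p.1 (M + 1) | h' n = M + 1 ∧ n ∉ U ∧ K ≤ n}) Prod.snd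
      (hE.toFinset ×ˢ Finset.range (M + 1))
      (by
        rintro ⟨β, m₀⟩ hp
        have hβ : β ∈ B := hEB β (by simpa using (Finset.mem_product.1 hp).1)
        refine ((hinf β hβ (M + 1)).sdiff (hh'.union (Set.finite_lt_nat K))).mono ?_
        rintro n ⟨⟨hn, hnM, hnU⟩, hn'⟩
        simp only [Set.mem_union, Set.mem_ofPred_eq, not_or, not_not, not_lt] at hn'
        exact ⟨hn, hn'.1.trans hnM, hnU, hn'.2⟩)
      (fun p _ n hn => hn.2.1)
      (fun p hp => by simpa using (Finset.mem_product.1 hp).2)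
    have hkeep : ∀ n, h' n ≠ M + 1 → h'' n = h' n := by
      intro n hn
      by_contra hcon
      obtain ⟨_, _, hW⟩ := hne n hcon
      exact hn hW.2.1
    refine ⟨h'', (hh'.union hh'').subset fun n hn => ?_, fun n hn => ?_, ?_⟩
    · by_cases hn' : h' n = h n
      · exact Or.inr (show h'' n ≠ h' n by rw [hn']; exact hn)
      · exact Or.inl hn'
    · rw [← hU n hn]
      by_contra hcon
      obtain ⟨_, _, hW⟩ := hne n hcon
      exact hW.2.2.1 hn
    · intro β hβ m₀ m₁ hlt hle
      rcases hle.lt_or_eq with hle | rfl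
      · obtain ⟨n, hn, hKn, hnm⟩ := hwit β hβ m₀ m₁ hlt (Nat.lt_succ_iff.1 hle)
        exact ⟨n, hn, hKn, by rw [hkeep n (by omega), hnm]⟩
      · by_cases hβE : β ∈ E
        · obtain ⟨n, hn, hnm⟩ := hwit' (β, m₀) (by simp [hβE, hlt])
          exact ⟨n, hn.1, hn.2.2.2, hnm⟩
        · have : ¬ ∀ n ∈ C β (M + 1), h' n = m₀ → n < K := fun hcon =>
            hβE (Set.mem_biUnion (by simpa using hlt) ⟨hβ, hcon⟩)
          push Not at this
          obtain ⟨n, hn, hnm, hKn⟩ := this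
          exact ⟨n, hn, hKn, by rw [hkeep n (by omega), hnm]⟩

/-! ### Extending a coherent family of colourings -/

theorem Set.Infinite.exists_coloring {D : Set ℕ} (hD : D.Infinite) :
    ∃ φ : ℕ → ℕ, ∀ m, {n ∈ D | φ n = m}.Infinite := by
  have := hD.to_subtype
  obtain ⟨e⟩ : Nonempty (ℕ × ℕ ≃ D) := nonempty_equiv_of_countable
  classical
  refine ⟨fun n => if h : n ∈ D then (e.symm ⟨n, h⟩).1 else 0, fun m => ?_⟩
  refine Set.infinite_of_injective_forall_mem (f := fun k : ℕ => ((e (m, k) : D) : ℕ))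
    (fun k l hkl => ?_) fun k => ⟨(e (m, k)).2, by simp⟩
  simpa using e.injective (Subtype.ext hkl)

/-- Dependent choice along `ℕ`. -/
theorem exists_seq_of_step {X : Type*} (P : ℕ → X → Prop) (R : ℕ → X → X → Prop) (x₀ : X)
    (h₀ : P 0 x₀) (step : ∀ k x, P k x → ∃ y, P (k + 1) y ∧ R k x y) :
    ∃ u : ℕ → X, ∀ k, P k (u k) ∧ R k (u k) (u (k + 1)) := by
  choose! s hs using step
  let u : ℕ → X := fun k => Nat.rec x₀ s k
  have hu : ∀ k, P k (u k) := fun k => Nat.rec h₀ (fun k ih => (hs k _ ih).1) k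
  exact ⟨u, fun k => ⟨hu k, (hs k _ (hu k)).2⟩⟩

/-- The colouring `g` of the level `T α` is a legitimate continuation of the colourings `F β`,
`β < α`: it is coherent with them, it satisfies Hausdorff's condition for every pair of colours
`m₀ < m₁`, and it uses every colour infinitely often above every lower level. The last clause is not
needed of the finished matrix; it keeps the recursion going. Colourings are total functions, of which
only the restriction to the level matters. -/
structure Extends {ι : Type*} [LinearOrder ι] (T : ι → Set ℕ) (F : ι → ℕ → ℕ) (α : ι)
    (g : ℕ → ℕ) : Prop where
  coherent : ∀ β < α, EqModFinOn (T β) g (F β)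
  hausdorff : ∀ m₀ m₁, m₀ < m₁ → ∀ r,
    {β | β < α ∧ ∀ n ∈ T α ∩ T β, g n = m₀ → F β n = m₁ → n < r}.Finite
  full : ∀ β < α, ∀ m, {n ∈ T α \ T β | g n = m}.Infinite

section Extension

variable {ι : Type*} [LinearOrder ι] {T : ι → Set ℕ} {F : ι → ℕ → ℕ}

/-- One step up a ladder, from level `δ` to level `γ`: a colouring `g` of `S =* T δ` is extended to
`S' =* T γ` so that all `β ∈ (δ, γ]` get witnesses `≥ k` for all pairs of colours `≤ k`. -/
theorem exists_ladder_step (hT : ∀ β α, β < α → StrictlyBelow (T β) (T α)) {δ γ : ι} (hδγ : δ ≤ γ)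
    (hF : ∀ β ≤ γ, Extends T F β (F β)) {S S' : Set ℕ} (hS : AlmostSubset S (T δ))
    (hS' : AlmostSubset (T γ) S') (hS'' : AlmostSubset S' (T γ)) (k : ℕ)
    (g : ℕ → ℕ) (hg : EqModFinOn S g (F δ)) :
    ∃ g' : ℕ → ℕ, EqModFinOn S' g' (F γ) ∧ (∀ n ∈ S, g' n = g n) ∧
      ∀ β ∈ Set.Ioc δ γ, ∀ m₀ m₁, m₀ < m₁ → m₁ ≤ k →
        ∃ n ∈ T β ∩ S', k ≤ n ∧ g' n = m₀ ∧ F β n = m₁ := by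
  classical
  have hTle : ∀ β ≤ γ, AlmostSubset (T β) (T γ) := fun β hβ => by
    rcases hβ.lt_or_eq with h | rfl
    · exact (hT β γ h).1
    · simp [AlmostSubset]
  have hFle : ∀ β ≤ γ, EqModFinOn (T β) (F γ) (F β) := fun β hβ => by
    rcases hβ.lt_or_eq with h | rfl
    · exact (hF γ le_rfl).coherent β h
    · exact .refl _ _
  let h : ℕ → ℕ := S.piecewise g (F γ)
  have hh : EqModFinOn Set.univ h (F γ) := by
    refine (hg.trans ((hFle δ hδγ).symm.mono hS)).subset fun n hn => ?_
    by_cases hnS : n ∈ S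
    · exact ⟨hnS, by simpa [h, hnS] using hn⟩
    · simp [h, hnS] at hn
  obtain ⟨h', hfin, hU, hwit⟩ := exists_recolor_forall (Set.Ioc δ γ)
    (fun β m => {n ∈ T β ∩ S' | F β n = m}) S k h
    (by
      intro m₀ m₁ hm r
      obtain ⟨R, hR⟩ := (hS'.union hh).exists_forall_lt_nat
      refine (((hF γ le_rfl).hausdorff m₀ m₁ hm (max R r)).insert γ).subset ?_
      rintro β ⟨⟨-, hβγ⟩, hβ⟩
      rcases hβγ.lt_or_eq with hlt | rfl
      · refine Or.inr ⟨hlt, fun n hn hn₀ hn₁ => ?_⟩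
        by_contra hcon
        have hnR : ¬ n < R := fun h => hcon (lt_max_of_lt_left h)
        have hnS' : n ∈ S' := by
          by_contra hc
          exact hnR (hR n (Or.inl ⟨hn.1, hc⟩))
        have hnh : h n = F γ n := by
          by_contra hc
          exact hnR (hR n (Or.inr ⟨trivial, hc⟩))
        exact hcon (lt_max_of_lt_right (hβ n ⟨⟨hn.2, hnS'⟩, hn₁⟩ (hnh.trans hn₀)))
      · exact Or.inl rfl)
    (by
      rintro β ⟨hδβ, hβγ⟩ m
      have hfinite := ((((hTle β hβγ).trans hS').union hS).union (hFle β hβγ)).union hh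
      refine (((hF β hβγ).full δ hδβ m).sdiff hfinite).mono ?_
      rintro n ⟨⟨⟨hnβ, hnδ⟩, hnm⟩, hn⟩
      simp only [Set.mem_union, not_or, Set.mem_sdiff, Set.mem_ofPred_eq, not_and, not_not] at hn
      obtain ⟨⟨⟨h1, h2⟩, h3⟩, h4⟩ := hn
      exact ⟨⟨⟨hnβ, h1 hnβ⟩, hnm⟩, by rw [h4 trivial, h3 hnβ, hnm], fun hnS => hnδ (h2 hnS)⟩)
    k
  refine ⟨h', ?_, fun n hn => ?_, fun β hβ m₀ m₁ hlt hle => ?_⟩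
  · refine (EqModFinOn.trans (g := h) ?_ (hh.mono (by simp [AlmostSubset])))
    exact hfin.subset fun n hn => hn.2
  · rw [hU n hn]
    simp [h, hn]
  · obtain ⟨n, hn, hkn, hnm⟩ := hwit β hβ m₀ m₁ hlt hle
    exact ⟨n, hn.1, hkn, hnm, hn.2⟩

/-- A level with countably many predecessors carries a legitimate continuation of the colourings of
the lower levels. -/
theorem exists_extends (hT : ∀ β α, β < α → StrictlyBelow (T β) (T α)) {α : ι}
    (hα : (Set.Iio α).Countable) (hF : ∀ β < α, Extends T F β (F β)) :
    ∃ g, Extends T F α g := by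
  classical
  rcases (Set.Iio α).eq_empty_or_nonempty with hempty | hne
  · have hno : ∀ β, ¬ β < α := fun β hβ => (hempty ▸ hβ : β ∈ (∅ : Set ι))
    exact ⟨0, fun β hβ => (hno β hβ).elim, fun _ _ _ _ => by simp [hno],
      fun β hβ => (hno β hβ).elim⟩
  obtain ⟨e, he⟩ := hα.exists_eq_range hne
  -- a cofinal monotone sequence, eventually constant when `α` is a successor
  let a : ℕ → ι := partialSups e
  have ha_mono : Monotone a := (partialSups e).monotone
  have ha_lt : ∀ k, a k < α := fun k =>
    (partialSups_iff_forall (fun x => x < α) max_lt_iff).2 fun j _ => by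
      change e j ∈ Set.Iio α
      rw [he]
      exact ⟨j, rfl⟩
  have ha_cof : ∀ β < α, ∃ k, β ≤ a k := by
    intro β hβ
    obtain ⟨k, rfl⟩ : β ∈ Set.range e := he ▸ hβ
    exact ⟨k, le_partialSups e k⟩
  have hTle : ∀ {β γ : ι}, β ≤ γ → AlmostSubset (T β) (T γ) := fun {β γ} hβ => by
    rcases hβ.lt_or_eq with h | rfl
    · exact (hT β γ h).1
    · simp [AlmostSubset]
  have hFle : ∀ {β γ : ι}, β ≤ γ → γ < α → EqModFinOn (T β) (F γ) (F β) := fun {β γ} hβ hγ => by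
    rcases hβ.lt_or_eq with h | rfl
    · exact (hF γ hγ).coherent β h
    · exact .refl _ _
  let S : ℕ → Set ℕ := fun k => T α ∩ ⋃ j ∈ Finset.range (k + 1), T (a j)
  have hS_mono : Monotone S := by
    intro k l hkl n hn
    simp only [S, Set.mem_inter_iff, Set.mem_iUnion, Finset.mem_range] at hn ⊢
    obtain ⟨h1, j, hj, h2⟩ := hn
    exact ⟨h1, j, by omega, h2⟩
  have hS_sub : ∀ k, AlmostSubset (S k) (T (a k)) := by
    intro k
    have : (⋃ j ∈ Finset.range (k + 1), T (a j) \ T (a k)).Finite :=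
      Set.Finite.biUnion (Finset.finite_toSet _) fun j hj =>
        hTle (ha_mono (Nat.lt_succ_iff.1 (by simpa using hj)))
    refine this.subset fun n hn => ?_
    simp only [S, Set.mem_inter_iff, Set.mem_iUnion, Set.mem_sdiff] at hn ⊢
    obtain ⟨⟨_, j, hj, h2⟩, h3⟩ := hn
    exact ⟨j, hj, h2, h3⟩
  have hS_sup : ∀ k, AlmostSubset (T (a k)) (S k) := by
    intro k
    refine (hTle (ha_lt k).le).subset fun n hn => ⟨hn.1, fun hnα => hn.2 ⟨hnα, ?_⟩⟩
    exact Set.mem_biUnion (by simp) hn.1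
  obtain ⟨g, hg⟩ := exists_seq_of_step (fun k g => EqModFinOn (S k) g (F (a k)))
    (fun k g g' => (∀ n ∈ S k, g' n = g n) ∧
      ∀ β ∈ Set.Ioc (a k) (a (k + 1)), ∀ m₀ m₁, m₀ < m₁ → m₁ ≤ k →
        ∃ n ∈ T β ∩ S (k + 1), k ≤ n ∧ g' n = m₀ ∧ F β n = m₁)
    (F (a 0)) (.refl _ _)
    (fun k g hg => exists_ladder_step hT (ha_mono (Nat.le_succ k))
      (fun β hβ => hF β (hβ.trans_lt (ha_lt _))) (hS_sub k) (hS_sup (k + 1)) (hS_sub (k + 1)) k g hg)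
  have hgl : ∀ k l, k ≤ l → ∀ n ∈ S k, g l n = g k n := by
    intro k l hkl n hn
    induction l, hkl using Nat.le_induction with
    | base => rfl
    | succ l hkl ih => rw [(hg l).2.1 n (hS_mono hkl hn), ih]
  obtain ⟨φ, hφ⟩ : ∃ φ : ℕ → ℕ, (T α \ ⋃ k, S k).Infinite →
      ∀ m, {n ∈ T α \ ⋃ k, S k | φ n = m}.Infinite := by
    by_cases hD : (T α \ ⋃ k, S k).Infinite
    · obtain ⟨φ, hφ⟩ := hD.exists_coloring
      exact ⟨φ, fun _ => hφ⟩
    · exact ⟨0, fun h => (hD h).elim⟩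
  let G : ℕ → ℕ := fun n => if h : ∃ k, n ∈ S k then g (Nat.find h) n else φ n
  have hGS : ∀ k, ∀ n ∈ S k, G n = g k n := by
    intro k n hn
    have h : ∃ k, n ∈ S k := ⟨k, hn⟩
    simp only [G, dif_pos h]
    exact (hgl _ _ (Nat.find_min' h hn) n (Nat.find_spec h)).symm
  have hGF : ∀ k, EqModFinOn (S k) G (F (a k)) := fun k =>
    (hg k).1.subset fun n hn => ⟨hn.1, by rw [← hGS k n hn.1]; exact hn.2⟩
  have hcoh : ∀ β < α, EqModFinOn (T β) G (F β) := by
    intro β hβ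
    obtain ⟨k, hk⟩ := ha_cof β hβ
    exact ((hGF k).mono ((hTle hk).trans (hS_sup k))).trans (hFle hk (ha_lt k))
  refine ⟨G, hcoh, fun m₀ m₁ hm r => ?_, fun β hβ m => ?_⟩
  · let k := max r m₁
    obtain ⟨R, hR⟩ := ((hS_sup k).union (hGF k)).exists_forall_lt_nat
    refine (((hF (a k) (ha_lt k)).hausdorff m₀ m₁ hm (max R r)).insert (a k)).subset ?_
    rintro β ⟨hβα, hβ⟩
    rcases lt_trichotomy β (a k) with hlt | heq | hgt
    · refine Or.inr ⟨hlt, fun n hn hn₀ hn₁ => ?_⟩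
      by_contra hcon
      have hnR : ¬ n < R := fun h => hcon (lt_max_of_lt_left h)
      have hnS : n ∈ S k := by
        by_contra hc
        exact hnR (hR n (Or.inl ⟨hn.1, hc⟩))
      have hnG : G n = F (a k) n := by
        by_contra hc
        exact hnR (hR n (Or.inr ⟨hnS, hc⟩))
      exact hcon (lt_max_of_lt_right (hβ n ⟨hnS.1, hn.2⟩ (hnG.trans hn₀) hn₁))
    · exact Or.inl heq
    · -- levels above `a k` received a witness `≥ k ≥ r` along the ladder
      exfalso
      have hex := ha_cof β hβα
      obtain ⟨j, hj⟩ : ∃ j, Nat.find hex = j + 1 := by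
        refine Nat.exists_eq_succ_of_ne_zero fun h0 => ?_
        have h1 : β ≤ a 0 := h0 ▸ Nat.find_spec hex
        exact absurd (h1.trans (ha_mono (Nat.zero_le k))) (not_le.2 hgt)
      have hjlt : a j < β := not_le.1 (Nat.find_min hex (by omega))
      have hjle : β ≤ a (j + 1) := hj ▸ Nat.find_spec hex
      have hkj : k ≤ j := by
        by_contra hcon
        exact absurd (hjle.trans (ha_mono (by omega : j + 1 ≤ k))) (not_le.2 hgt)
      have hrk : r ≤ k := le_max_left _ _
      have hmk : m₁ ≤ k := le_max_right _ _
      obtain ⟨n, hn, hjn, hn₀, hn₁⟩ := (hg j).2.2 β ⟨hjlt, hjle⟩ m₀ m₁ hm (by omega)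
      have := hβ n ⟨hn.2.1, hn.1⟩ ((hGS (j + 1) n hn.2).trans hn₀) hn₁
      omega
  · by_cases hmid : ∃ γ, β < γ ∧ γ < α
    · obtain ⟨γ, hβγ, hγα⟩ := hmid
      refine (((hF γ hγα).full β hβγ m).sdiff ((hTle hγα.le).union (hcoh γ hγα))).mono ?_
      rintro n ⟨⟨⟨hnγ, hnβ⟩, hnm⟩, hn⟩
      simp only [Set.mem_union, not_or, Set.mem_sdiff, Set.mem_ofPred_eq, not_and, not_not] at hn
      exact ⟨⟨hn.1 hnγ, hnβ⟩, (hn.2 hnγ).trans hnm⟩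
    · -- `α` is the successor of `β`, so that the ladder only covers `T β` modulo finite
      push Not at hmid
      have hle : ∀ k, a k ≤ β := fun k => not_lt.1 fun h => (hmid _ h).not_gt (ha_lt k)
      obtain ⟨K, hK⟩ := ha_cof β hβ
      have hSK : (⋃ k, S k) ⊆ S K := by
        refine Set.iUnion_subset fun k n hn => ?_
        simp only [S, Set.mem_inter_iff, Set.mem_iUnion, Finset.mem_range] at hn ⊢
        obtain ⟨hnα, j, hj, hnj⟩ := hn
        by_cases hjK : j < K + 1
        · exact ⟨hnα, j, hjK, hnj⟩
        · have : a j = a K :=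
            le_antisymm ((hle j).trans hK) (ha_mono (by omega))
          exact ⟨hnα, K, by omega, this ▸ hnj⟩
      have hSβ : AlmostSubset (S K) (T β) := (hS_sub K).trans (hTle (hle K))
      have hTS : AlmostSubset (T β) (S K) := (hTle hK).trans (hS_sup K)
      have hD : (T α \ ⋃ k, S k).Infinite := by
        refine ((hT β α hβ).2.sdiff hSβ).mono ?_
        rintro n ⟨⟨hnα, hnβ⟩, hn⟩
        exact ⟨hnα, fun hc => hn ⟨hSK hc, hnβ⟩⟩
      refine ((hφ hD m).sdiff hTS).mono ?_
      rintro n ⟨⟨⟨hnα, hnS⟩, hnm⟩, hn⟩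
      refine ⟨⟨hnα, fun hnβ => hn ⟨hnβ, fun hc => hnS (Set.mem_iUnion_of_mem K hc)⟩⟩, ?_⟩
      have : ¬ ∃ k, n ∈ S k := fun ⟨k, hk⟩ => hnS (Set.mem_iUnion_of_mem k hk)
      simp only [G, dif_neg this, hnm]

theorem Extends.congr {F' : ι → ℕ → ℕ} {α : ι} {g : ℕ → ℕ} (h : Extends T F α g)
    (hF : ∀ β < α, F β = F' β) : Extends T F' α g where
  coherent β hβ := hF β hβ ▸ h.coherent β hβ
  hausdorff m₀ m₁ hm r := (h.hausdorff m₀ m₁ hm r).subset fun β hβ =>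
    ⟨hβ.1, by rw [hF β hβ.1]; exact hβ.2⟩
  full := h.full

theorem exists_forall_extends [WellFoundedLT ι] (hT : ∀ β α, β < α → StrictlyBelow (T β) (T α))
    (hι : ∀ α : ι, (Set.Iio α).Countable) : ∃ F : ι → ℕ → ℕ, ∀ α, Extends T F α (F α) := by
  classical
  let ext : (α : ι) → ((β : ι) → β < α → ℕ → ℕ) → ℕ → ℕ := fun α f =>
    Classical.epsilon (Extends T (fun β => if h : β < α then f β h else 0) α)
  let F : ι → ℕ → ℕ := WellFoundedLT.fix ext
  refine ⟨F, fun α => ?_⟩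
  induction α using WellFoundedLT.induction with
  | ind α ih =>
    have hF : F α = Classical.epsilon (Extends T (fun β => if β < α then F β else 0) α) := by
      have := WellFoundedLT.fix_eq ext α
      simpa only [ext, dite_eq_ite] using this
    obtain ⟨g, hg⟩ := exists_extends hT (hι α) ih
    have hspec := Classical.epsilon_spec (p := Extends T (fun β => if β < α then F β else 0) α)
      ⟨g, hg.congr fun β hβ => by simp [hβ]⟩
    rw [← hF] at hspec
    exact hspec.congr fun β hβ => by simp [hβ]

end Extension

/-! ### The gap matrix of a strictly increasing tower -/

theorem OmegaOne.countable_Iio (α : OmegaOne) : (Set.Iio α).Countable := by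
  have h : (Set.Iio (α : Ordinal.{0})).Countable := by
    rw [← Cardinal.le_aleph0_iff_set_countable, Cardinal.mk_Iio_ordinal, Cardinal.lift_le_aleph0,
      ← Order.lt_succ_iff, Cardinal.succ_aleph0, ← Cardinal.lt_ord, Cardinal.ord_aleph]
    exact α.2
  exact (h.preimage Subtype.val_injective).mono fun β hβ => hβ

instance OmegaOne.uncountable : Uncountable OmegaOne := by
  rw [← Cardinal.aleph0_lt_mk_iff, Cardinal.mk_Iio_ordinal, Cardinal.aleph0_lt_lift,
    Ordinal.card_omega]
  exact Cardinal.aleph0_lt_aleph_one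

/-- The colour classes of a coherent family of colourings satisfying Hausdorff's condition form a
gap matrix. -/
theorem IsStrictTower.exists_isGapMatrix {T : OmegaOne → Set ℕ} (hT : IsStrictTower T) :
    ∃ A : ℕ → OmegaOne → Set ℕ, IsGapMatrix T A := by
  obtain ⟨F, hF⟩ := exists_forall_extends hT OmegaOne.countable_Iio
  refine ⟨fun m α => {n ∈ T α | F α n = m}, fun m => ⟨?_, ?_, ?_⟩, ?_, ?_, ?_, ?_⟩
  · intro β α hβ
    refine ((hT β α hβ).1.union ((hF α).coherent β hβ)).subset ?_
    rintro n ⟨⟨hn, hnm⟩, hn'⟩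
    by_cases hα : n ∈ T α
    · exact Or.inr ⟨hn, fun h => hn' ⟨hα, h.trans hnm⟩⟩
    · exact Or.inl ⟨hn, hα⟩
  · exact fun α n hn => hn.1
  · intro β α hβ
    refine ((hF α).coherent β hβ).subset ?_
    rintro n ⟨⟨-, hnm⟩, hn, hn'⟩
    exact ⟨hn, fun h => hn' ⟨hn, h.symm.trans hnm⟩⟩
  · intro m₀ m₁ hm α r
    refine ((hF α).hausdorff m₀ m₁ hm r).subset ?_
    rintro β ⟨hβ, h⟩
    exact ⟨hβ, fun n hn h₀ h₁ => h ⟨⟨hn.1, h₀⟩, hn.2, h₁⟩⟩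
  · intro α β hβ
    have hfin := (hT β α hβ).1.union ((hF α).coherent β hβ)
    obtain ⟨R, hR⟩ := ((hfin.image (F α)).union (hfin.image (F β))).exists_forall_lt_nat
    refine ⟨R, fun m hm => Set.ext fun n => ⟨?_, ?_⟩⟩
    · rintro ⟨⟨-, hnm⟩, hn⟩
      refine ⟨hn, ?_⟩
      by_contra hne
      have := hR (F α n) (Or.inl ⟨n, Or.inr ⟨hn, fun h => hne (h.symm.trans hnm)⟩, rfl⟩)
      omega
    · rintro ⟨hn, hnm⟩
      have hnot : n ∉ (T β \ T α) ∪ {n ∈ T β | F α n ≠ F β n} := fun hc => by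
        have := hR (F β n) (Or.inr ⟨n, hc, rfl⟩)
        omega
      simp only [Set.mem_union, not_or, Set.mem_sdiff, Set.mem_ofPred_eq, not_and, not_not] at hnot
      exact ⟨⟨hnot.1 hn, (hnot.2 hn).trans hnm⟩, hn⟩
  · intro α
    ext n
    simp
  · intro α m m' hne
    exact Set.disjoint_left.2 fun n hn hn' => hne (hn.2.symm.trans hn'.2)

/-! ### Unions of columns are gaps -/

theorem OmegaOne.exists_infinite_inter_Iio {s : Set OmegaOne} (hs : ¬ s.Countable) :
    ∃ α ∈ s, {β ∈ s | β < α}.Infinite := by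
  have hinf : s.Infinite := fun h => hs h.countable
  obtain ⟨c, hcs, hci, hcc⟩ : ∃ c ⊆ s, c.Infinite ∧ c.Countable := by
    refine ⟨Set.range fun n => (hinf.natEmbedding s n : OmegaOne), ?_, ?_, Set.countable_range _⟩
    · rintro _ ⟨n, rfl⟩
      exact (hinf.natEmbedding s n).2
    · exact Set.infinite_range_of_injective
        (Subtype.val_injective.comp (hinf.natEmbedding s).injective)
  have hcount : (⋃ β ∈ c, Set.Iic β).Countable := hcc.biUnion fun β _ => by
    rw [← Set.Iio_insert]
    exact (OmegaOne.countable_Iio β).insert β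
  obtain ⟨α, hαs, hα⟩ : ∃ α ∈ s, α ∉ ⋃ β ∈ c, Set.Iic β := by
    by_contra! hcon
    exact hs (hcount.mono hcon)
  refine ⟨α, hαs, hci.mono fun β hβ => ⟨hcs hβ, ?_⟩⟩
  simp only [Set.mem_iUnion, Set.mem_Iic, not_exists, not_le] at hα
  exact hα β hβ

theorem OmegaOne.exists_infinite_eq (r : OmegaOne → ℕ) : ∃ α, {β | β < α ∧ r β = r α}.Infinite := by
  obtain ⟨k, hk⟩ : ∃ k, ¬ (r ⁻¹' {k}).Countable := by
    by_contra! hcon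
    refine Set.not_countable_univ (α := OmegaOne) ((Set.countable_iUnion hcon).mono fun α _ => ?_)
    exact Set.mem_iUnion.2 ⟨r α, rfl⟩
  obtain ⟨α, hα, hinf⟩ := OmegaOne.exists_infinite_inter_Iio hk
  exact ⟨α, hinf.mono fun β hβ => ⟨hβ.2, (show r β = k from hβ.1).trans (Eq.symm hα)⟩⟩

namespace IsGapMatrix

variable {T : OmegaOne → Set ℕ} {A : ℕ → OmegaOne → Set ℕ}

theorem subset (hA : IsGapMatrix T A) (m : ℕ) (α : OmegaOne) : A m α ⊆ T α :=
  (hA.subtower m).2.1 α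

theorem eq_of_mem (hA : IsGapMatrix T A) {α : OmegaOne} {m m' n : ℕ} (h : n ∈ A m α)
    (h' : n ∈ A m' α) : m = m' := by
  by_contra hne
  exact Set.disjoint_left.1 (hA.disjoint α m m' hne) h h'

/-- Two rows of a gap matrix partition the lower level in the same way, up to finitely many
points. -/
theorem finite_disagreement (hA : IsGapMatrix T A) {α β : OmegaOne} (hβ : β < α) :
    {n ∈ T β | ∃ m, ¬ (n ∈ A m α ↔ n ∈ A m β)}.Finite := by
  obtain ⟨m₀, hm₀⟩ := hA.coherent α β hβ
  have hfin : (⋃ m ∈ Set.Iic m₀, (A m β \ A m α) ∪ (A m α ∩ (T β \ A m β))).Finite :=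
    (Set.finite_Iic m₀).biUnion fun m _ =>
      ((hA.subtower m).1 β α hβ).union ((hA.subtower m).2.2 β α hβ)
  refine hfin.subset ?_
  rintro n ⟨hn, m, hm⟩
  refine Set.mem_biUnion (x := m) ?_ ?_
  · by_contra hcon
    have := Set.ext_iff.1 (hm₀ m (not_le.1 hcon)) n
    simp only [Set.mem_inter_iff, hn, and_true] at this
    exact hm this
  · simp only [Set.mem_union, Set.mem_sdiff, Set.mem_inter_iff]
    tauto

theorem mem_columnUnion_iff (hA : IsGapMatrix T A) {X : Set ℕ} {α : OmegaOne} {m n : ℕ}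
    (h : n ∈ A m α) : n ∈ columnUnion A X α ↔ m ∈ X := by
  simp only [columnUnion, Set.mem_iUnion]
  exact ⟨fun ⟨m', hm', h'⟩ => hA.eq_of_mem h h' ▸ hm', fun hm => ⟨m, hm, h⟩⟩

theorem exists_mem (hA : IsGapMatrix T A) {α : OmegaOne} {n : ℕ} (hn : n ∈ T α) :
    ∃ m, n ∈ A m α := by
  rw [hA.union α] at hn
  exact Set.mem_iUnion.1 hn

theorem columnUnion_subset (hA : IsGapMatrix T A) (X : Set ℕ) (α : OmegaOne) :
    columnUnion A X α ⊆ T α :=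
  Set.iUnion₂_subset fun m _ => hA.subset m α

theorem columnUnion_compl (hA : IsGapMatrix T A) (X : Set ℕ) (α : OmegaOne) :
    columnUnion A Xᶜ α = T α \ columnUnion A X α := by
  ext n
  by_cases hn : n ∈ T α
  · obtain ⟨m, hm⟩ := hA.exists_mem hn
    simp [hn, hA.mem_columnUnion_iff hm]
  · exact ⟨fun h => (hn (hA.columnUnion_subset _ _ h)).elim, fun h => (hn h.1).elim⟩

theorem columnUnion_symmDiff (hA : IsGapMatrix T A) (X Y : Set ℕ) (α : OmegaOne) :
    columnUnion A X α ∆ columnUnion A Y α = columnUnion A (X ∆ Y) α := by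
  ext n
  by_cases hn : n ∈ T α
  · obtain ⟨m, hm⟩ := hA.exists_mem hn
    simp [Set.mem_symmDiff, hA.mem_columnUnion_iff hm]
  · refine ⟨fun h => (hn ?_).elim, fun h => (hn (hA.columnUnion_subset _ _ h)).elim⟩
    rcases h with h | h <;> exact hA.columnUnion_subset _ _ h.1

theorem finite_columnUnion_disagreement (hA : IsGapMatrix T A) (X : Set ℕ) {α β : OmegaOne}
    (hβ : β < α) : {n ∈ T β | ¬ (n ∈ columnUnion A X α ↔ n ∈ columnUnion A X β)}.Finite := by
  refine (hA.finite_disagreement hβ).subset ?_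
  rintro n ⟨hn, hX⟩
  refine ⟨hn, ?_⟩
  by_contra! hcon
  exact hX (by simp [columnUnion, hcon])

theorem isTower (hA : IsGapMatrix T A) : IsTower T := by
  intro β α hβ
  refine (hA.finite_disagreement hβ).subset ?_
  rintro n ⟨hn, hnα⟩
  obtain ⟨m, hm⟩ := hA.exists_mem hn
  exact ⟨hn, m, fun h => hnα (hA.subset m α (h.2 hm))⟩

theorem isSubtower_columnUnion (hA : IsGapMatrix T A) (X : Set ℕ) :
    IsSubtower (columnUnion A X) T := by
  refine ⟨fun β α hβ => ?_, hA.columnUnion_subset X, fun β α hβ => ?_⟩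
  · refine (hA.finite_columnUnion_disagreement X hβ).subset ?_
    rintro n ⟨hn, hn'⟩
    exact ⟨hA.columnUnion_subset X β hn, fun h => hn' (h.2 hn)⟩
  · refine (hA.finite_columnUnion_disagreement X hβ).subset ?_
    rintro n ⟨hn, hnT, hn'⟩
    exact ⟨hnT, fun h => hn' (h.1 hn)⟩

/-- Hausdorff's argument: two columns of a gap matrix cannot be separated. A separating set would be
correct above a fixed bound `r` for `α` and for infinitely many `β < α`, so that
`A m₀ α ∩ A m₁ β ⊆ r` for all these `β`. -/
theorem not_separated (hA : IsGapMatrix T A) {m₀ m₁ : ℕ} (hm : m₀ < m₁) (Z : Set ℕ) :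
    ¬ ∀ α, AlmostSubset (A m₀ α) Z ∧ (Z ∩ A m₁ α).Finite := by
  intro h
  choose r hr using fun α => ((h α).1.union (h α).2).exists_forall_lt_nat
  obtain ⟨α, hα⟩ := OmegaOne.exists_infinite_eq r
  refine hα ((hA.meet m₀ m₁ hm α (r α)).subset ?_)
  rintro β ⟨hβ, hrβ⟩
  refine ⟨hβ, fun n hn => ?_⟩
  by_cases hnZ : n ∈ Z
  · exact hrβ ▸ hr β n (Or.inr ⟨hnZ, hn.2⟩)
  · exact hr α n (Or.inl ⟨hn.1, hnZ⟩)

theorem isGapIn_columnUnion (hA : IsGapMatrix T A) {X : Set ℕ} (hX : X ≠ ∅) (hX' : X ≠ Set.univ) :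
    IsGapIn (columnUnion A X) T := by
  have hcompl : (fun α => T α \ columnUnion A X α) = columnUnion A Xᶜ :=
    funext fun α => (hA.columnUnion_compl X α).symm
  refine ⟨hA.isSubtower_columnUnion X, ⟨(hA.isSubtower_columnUnion X).1, ?_, fun α => ?_⟩, ?_⟩
  · rw [hcompl]
    exact (hA.isSubtower_columnUnion Xᶜ).1
  · simp
  · rintro ⟨Z, hZ⟩
    have hin : ∀ m ∈ X, ∀ α, AlmostSubset (A m α) Z := fun m hm α =>
      (hZ α).1.subset fun n hn => ⟨Set.mem_biUnion hm hn.1, hn.2⟩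
    have hout : ∀ m ∉ X, ∀ α, (Z ∩ A m α).Finite := fun m hm α =>
      (hZ α).2.subset fun n hn => ⟨hn.1, hA.subset m α hn.2, fun hc =>
        hm ((hA.mem_columnUnion_iff hn.2).1 hc)⟩
    obtain ⟨m, hm⟩ := Set.nonempty_iff_ne_empty.2 hX
    obtain ⟨m', hm'⟩ := (Set.ne_univ_iff_exists_notMem X).1 hX'
    rcases lt_trichotomy m m' with hlt | rfl | hlt
    · exact hA.not_separated hlt Z fun α => ⟨hin m hm α, hout m' hm' α⟩
    · exact hm' hm
    · refine hA.not_separated hlt Zᶜ fun α => ⟨(hout m' hm' α).subset ?_, (hin m hm α).subset ?_⟩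
      · exact fun n hn => ⟨not_not.1 hn.2, hn.1⟩
      · exact fun n hn => ⟨hn.2, hn.1⟩

theorem isGapIn_columnUnion_symmDiff (hA : IsGapMatrix T A) {X Y : Set ℕ} (hXY : X ≠ Y)
    (hXY' : Y ≠ Xᶜ) : IsGapIn (columnUnion A (X ∆ Y)) T := by
  refine hA.isGapIn_columnUnion (fun h => hXY (symmDiff_eq_bot.1 h)) fun h => hXY' ?_
  exact ((symmDiff_eq_top X Y).1 h).compl_eq.symm

end IsGapMatrix

/-! ### Cocycles from coherent families of functions -/

/-- The one-term chain `D`. -/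
def DescChain.single {𝒟 : Set (Set ℕ)} {D : Set ℕ} (hD : D ∈ 𝒟) : DescChain 𝒟 0 where
  sets _ := D
  mem _ := hD
  desc := antitone_const

/-- The two-term chain `D ⊇ E`. -/
def DescChain.pair {𝒟 : Set (Set ℕ)} {D E : Set ℕ} (hD : D ∈ 𝒟) (hE : E ∈ 𝒟) (h : E ⊆ D) :
    DescChain 𝒟 1 where
  sets := ![D, E]
  mem i := by fin_cases i <;> assumption
  desc := by
    intro i j hij
    fin_cases i <;> fin_cases j <;> simp_all

theorem DescChain.face_pair_zero {𝒟 : Set (Set ℕ)} {D E : Set ℕ} (hD : D ∈ 𝒟) (hE : E ∈ 𝒟)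
    (h : E ⊆ D) : (DescChain.pair hD hE h).face 0 = DescChain.single hE := by
  simp only [DescChain.face, DescChain.single, DescChain.mk.injEq]
  funext j
  fin_cases j
  rfl

theorem DescChain.face_pair_one {𝒟 : Set (Set ℕ)} {D E : Set ℕ} (hD : D ∈ 𝒟) (hE : E ∈ 𝒟)
    (h : E ⊆ D) : (DescChain.pair hD hE h).face 1 = DescChain.single hD := by
  simp only [DescChain.face, DescChain.single, DescChain.mk.injEq]
  funext j
  fin_cases j
  rfl

theorem Cochain.apply_congr {𝒟 : Set (Set ℕ)} {n : ℕ} (y : Cochain 𝒟 n) {c c' : DescChain 𝒟 n}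
    (h : c = c') {k : ℕ} (hk : k ∈ c.smallest) (hk' : k ∈ c'.smallest) :
    y c ⟨k, hk⟩ = y c' ⟨k, hk'⟩ := by
  subst h
  rfl

theorem FinCoeff.restrict_apply {D E : Set ℕ} (h : E ⊆ D) (x : FinCoeff D) (n : E) :
    FinCoeff.restrict h x n = x ⟨n, h n.2⟩ := rfl

theorem coboundary_zero_apply {𝒟 : Set (Set ℕ)} (x : Cochain 𝒟 0) (c : DescChain 𝒟 1)
    (k : c.smallest) : coboundary 𝒟 0 x c k =
      x (c.face 0) ⟨k, c.smallest_subset_face 0 k.2⟩ -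
        x (c.face 1) ⟨k, c.smallest_subset_face 1 k.2⟩ := by
  change (∑ i : Fin 2, (-1 : ℤ) ^ (i : ℕ) •
    FinCoeff.restrict (c.smallest_subset_face i) (x (c.face i))) k = _
  rw [Fin.sum_univ_two, Finsupp.add_apply, Finsupp.smul_apply, Finsupp.smul_apply,
    FinCoeff.restrict_apply, FinCoeff.restrict_apply]
  simp [sub_eq_add_neg]

theorem coboundary_one_apply {𝒟 : Set (Set ℕ)} (x : Cochain 𝒟 1) (c : DescChain 𝒟 2)
    (k : c.smallest) : coboundary 𝒟 1 x c k =
      x (c.face 0) ⟨k, c.smallest_subset_face 0 k.2⟩ -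
        x (c.face 1) ⟨k, c.smallest_subset_face 1 k.2⟩ +
        x (c.face 2) ⟨k, c.smallest_subset_face 2 k.2⟩ := by
  change (∑ i : Fin 3, (-1 : ℤ) ^ (i : ℕ) •
    FinCoeff.restrict (c.smallest_subset_face i) (x (c.face i))) k = _
  rw [Fin.sum_univ_three, Finsupp.add_apply, Finsupp.add_apply, Finsupp.smul_apply,
    Finsupp.smul_apply, Finsupp.smul_apply, FinCoeff.restrict_apply, FinCoeff.restrict_apply,
    FinCoeff.restrict_apply]
  simp [sub_eq_add_neg]

/-- A family of functions `a D : D → ℤ/2` (given by total functions on `ω`) is coherent if `a D` and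
`a E` agree on `E` modulo finite whenever `E ⊆ D`. -/
def IsCoherentFamily (𝒟 : Set (Set ℕ)) (a : Set ℕ → ℕ → ZMod 2) : Prop :=
  ∀ D ∈ 𝒟, ∀ E ∈ 𝒟, E ⊆ D → {n ∈ E | a E n ≠ a D n}.Finite

namespace IsCoherentFamily

variable {𝒟 : Set (Set ℕ)} {a b : Set ℕ → ℕ → ZMod 2}

/-- The formal coboundary `(D₀ ⊇ D₁) ↦ a D₁ - a D₀ ↾ D₁` of a coherent family of functions. The
functions `a D` need not be finitely supported, so this is in general not a coboundary. -/
noncomputable def cochain (ha : IsCoherentFamily 𝒟 a) : Cochain 𝒟 1 := fun c =>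
  Finsupp.ofSupportFinite (fun n : c.smallest => a (c.sets 1) n - a (c.sets 0) n) <| by
    refine Set.Finite.of_finite_image ((ha (c.sets 0) (c.mem 0) (c.sets 1) (c.mem 1)
      (c.desc (Fin.zero_le 1))).subset ?_) Subtype.val_injective.injOn
    rintro _ ⟨n, hn, rfl⟩
    exact ⟨n.2, sub_ne_zero.1 hn⟩

theorem cochain_apply (ha : IsCoherentFamily 𝒟 a) (c : DescChain 𝒟 1) (n : c.smallest) :
    ha.cochain c n = a (c.sets 1) n - a (c.sets 0) n := rfl

theorem cochain_mem_ker (ha : IsCoherentFamily 𝒟 a) : ha.cochain ∈ (coboundary 𝒟 1).ker := by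
  rw [AddMonoidHom.mem_ker]
  funext c
  ext n
  rw [coboundary_one_apply, cochain_apply, cochain_apply, cochain_apply]
  change a (c.sets 2) n - a (c.sets 1) n - (a (c.sets 2) n - a (c.sets 0) n) +
    (a (c.sets 1) n - a (c.sets 0) n) = 0
  ring

/-- The cohomology class of the cocycle given by a coherent family of functions. -/
noncomputable def cohomologyClass (ha : IsCoherentFamily 𝒟 a) : FirstCohomology 𝒟 :=
  QuotientAddGroup.mk ⟨ha.cochain, ha.cochain_mem_ker⟩

/-- If two coherent families over a directed family of sets have the same cohomology class, then
their difference is trivial modulo finite: it is induced, up to finitely many points of each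
`D`, by a single subset of `ω`. -/
theorem exists_set_of_cohomologyClass_eq (hdir : DirectedOn (· ⊆ ·) 𝒟)
    (ha : IsCoherentFamily 𝒟 a) (hb : IsCoherentFamily 𝒟 b)
    (hab : ha.cohomologyClass = hb.cohomologyClass) :
    ∃ Z : Set ℕ, ∀ D ∈ 𝒟, {n ∈ D | ¬ (n ∈ Z ↔ a D n ≠ b D n)}.Finite := by
  obtain ⟨y, hy⟩ : hb.cochain - ha.cochain ∈ (coboundary 𝒟 0).range := by
    have := QuotientAddGroup.eq.1 hab
    rw [AddSubgroup.mem_addSubgroupOf] at this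
    simpa [sub_eq_neg_add] using this
  -- subtracting `y` from `b - a` gives functions `d D` which restrict exactly
  let d : ∀ D ∈ 𝒟, ∀ n ∈ D, ZMod 2 := fun D hD n hn =>
    b D n - a D n - y (DescChain.single hD) ⟨n, hn⟩
  have hd : ∀ D (hD : D ∈ 𝒟) E (hE : E ∈ 𝒟) (h : E ⊆ D) n (hn : n ∈ E),
      d E hE n hn = d D hD n (h hn) := by
    intro D hD E hE h n hn
    have hfun := DFunLike.congr_fun (congrFun hy (DescChain.pair hD hE h))
      (⟨n, hn⟩ : (DescChain.pair hD hE h).smallest)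
    rw [coboundary_zero_apply] at hfun
    rw [y.apply_congr (DescChain.face_pair_zero hD hE h) _ hn,
      y.apply_congr (DescChain.face_pair_one hD hE h) _ (h hn)] at hfun
    have hba : (hb.cochain - ha.cochain) (DescChain.pair hD hE h)
        (⟨n, hn⟩ : (DescChain.pair hD hE h).smallest) = (b E n - b D n) - (a E n - a D n) := rfl
    rw [hba] at hfun
    simp only [d]
    linear_combination -hfun
  have hd' : ∀ D (hD : D ∈ 𝒟) E (hE : E ∈ 𝒟) n (hn : n ∈ D) (hn' : n ∈ E),
      d D hD n hn = d E hE n hn' := by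
    intro D hD E hE n hn hn'
    obtain ⟨G, hG, hDG, hEG⟩ := hdir D hD E hE
    rw [hd G hG D hD hDG, hd G hG E hE hEG]
  refine ⟨{n | ∃ D, ∃ (hD : D ∈ 𝒟) (hn : n ∈ D), d D hD n hn ≠ 0}, fun D hD => ?_⟩
  refine ((y (DescChain.single hD)).hasFiniteSupport.image Subtype.val).subset ?_
  rintro n ⟨hn, hne⟩
  refine ⟨⟨n, hn⟩, fun hy0 => hne ?_, rfl⟩
  have hdD : d D hD n hn = b D n - a D n := by simp only [d, hy0, sub_zero]
  constructor
  · rintro ⟨E, hE, hnE, h⟩ heq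
    rw [hd' E hE D hD n hnE hn, hdD, heq, sub_self] at h
    exact h rfl
  · intro h
    refine ⟨D, hD, hn, ?_⟩
    rw [hdD]
    exact sub_ne_zero.2 h.symm

end IsCoherentFamily

/-! ### The size of the gap cohomology group -/

theorem directedOn_upwardFamily {T : OmegaOne → Set ℕ} (hT : IsTower T) :
    DirectedOn (· ⊆ ·) (upwardFamily T) := by
  have key : ∀ {D E : Set ℕ} {α β : OmegaOne}, T β ⊆ D → (D \ T β).Finite → T α ⊆ E →
      (E \ T α).Finite → β ≤ α → D ∪ E ∈ upwardFamily T := by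
    intro D E α β hD hD' hE hE' hβ
    refine ⟨α, hE.trans Set.subset_union_right, ?_⟩
    have hTβ : AlmostSubset (T β) (T α) := by
      rcases hβ.lt_or_eq with h | rfl
      · exact hT β α h
      · simp [AlmostSubset]
    rw [Set.union_sdiff_distrib]
    exact (AlmostSubset.trans hD' hTβ).union hE'
  rintro D ⟨α, hD, hD'⟩ E ⟨β, hE, hE'⟩
  refine ⟨D ∪ E, ?_, Set.subset_union_left, Set.subset_union_right⟩
  rcases le_total α β with h | h
  · exact key hD hD' hE hE' h
  · rw [Set.union_comm]
    exact key hE hE' hD hD' h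

/-- In a strictly increasing tower the almost inclusion of levels reflects their order. -/
theorem IsStrictTower.le_of_almostSubset {T : OmegaOne → Set ℕ} (hT : IsStrictTower T)
    {α β : OmegaOne} (h : AlmostSubset (T β) (T α)) : β ≤ α := by
  by_contra hlt
  exact (hT α β (not_le.1 hlt)).2 h

theorem IsStrictTower.continuum_le_mk_gapCohomology {T : OmegaOne → Set ℕ} (hT : IsStrictTower T)
    {A : ℕ → OmegaOne → Set ℕ} (hA : IsGapMatrix T A) : 𝔠 ≤ #(GapCohomology T) := by
  classical
  have : Nonempty OmegaOne := (inferInstance : Infinite OmegaOne).nonempty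
  have hlev : ∀ D ∈ upwardFamily T, ∃ α, T α ⊆ D ∧ (D \ T α).Finite := fun D hD => hD
  choose! lev hsub hfin using hlev
  let a : Set ℕ → Set ℕ → ℕ → ZMod 2 := fun X D n =>
    if n ∈ columnUnion A X (lev D) then 1 else 0
  have ha : ∀ X, IsCoherentFamily (upwardFamily T) (a X) := by
    intro X D hD E hE hED
    have hle : lev E ≤ lev D := hT.le_of_almostSubset <|
      (hfin D hD).subset fun n hn => ⟨hED (hsub E hE hn.1), hn.2⟩
    rcases hle.lt_or_eq with hlt | heq
    · refine ((hfin E hE).union (hA.finite_columnUnion_disagreement X hlt)).subset ?_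
      rintro n ⟨hn, hne⟩
      by_cases hnT : n ∈ T (lev E)
      · refine Or.inr ⟨hnT, fun hc => hne ?_⟩
        simp only [a, hc]
      · exact Or.inl ⟨hn, hnT⟩
    · simp [a, heq]
  have hmem : ∀ α, T α ∈ upwardFamily T := fun α => ⟨α, subset_rfl, by simp⟩
  have hlevT : ∀ α, lev (T α) = α := fun α => le_antisymm
    (hT.le_of_almostSubset (by simp [AlmostSubset, Set.sdiff_eq_empty.2 (hsub _ (hmem α))]))
    (hT.le_of_almostSubset (hfin _ (hmem α)))
  -- sets containing `0` are never complementary to each other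
  let X : Set ℕ → Set ℕ := fun s => insert 0 (Nat.succ '' s)
  have hX : Function.Injective X := by
    intro s t hst
    ext n
    simpa [X] using Set.ext_iff.1 hst (n + 1)
  rw [← Cardinal.mk_set_nat]
  refine Cardinal.mk_le_of_injective (f := fun s => (ha (X s)).cohomologyClass) fun s t hst => ?_
  by_contra hne
  obtain ⟨Z, hZ⟩ := IsCoherentFamily.exists_set_of_cohomologyClass_eq
    (directedOn_upwardFamily hA.isTower) (ha (X s)) (ha (X t)) hst
  have hgap := hA.isGapIn_columnUnion_symmDiff (X := X s) (Y := X t) (hX.ne hne) fun h => by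
    have h0 : (0 : ℕ) ∈ X t := Or.inl rfl
    rw [h] at h0
    exact h0 (Or.inl rfl)
  have hiff : ∀ α n, a (X s) (T α) n ≠ a (X t) (T α) n ↔ n ∈ columnUnion A (X s ∆ X t) α := by
    intro α n
    rw [← hA.columnUnion_symmDiff, Set.mem_symmDiff]
    simp only [a, hlevT]
    by_cases h₁ : n ∈ columnUnion A (X s) α <;> by_cases h₂ : n ∈ columnUnion A (X t) α <;>
      simp [h₁, h₂]
  refine hgap.2.2 ⟨Z, fun α => ⟨(hZ _ (hmem α)).subset ?_, (hZ _ (hmem α)).subset ?_⟩⟩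
  · rintro n ⟨hn, hnZ⟩
    exact ⟨hA.columnUnion_subset _ _ hn, fun h => hnZ (h.2 ((hiff α n).2 hn))⟩
  · rintro n ⟨hnZ, hnT, hn⟩
    exact ⟨hnT, fun h => hn ((hiff α n).1 (h.1 hnZ))⟩

theorem corollary18 (T : OmegaOne → Set ℕ) (hT : IsStrictTower T) :
    𝔠 ≤ #(GapCohomology T) ∧
    (∃ A : ℕ → OmegaOne → Set ℕ, IsGapMatrix T A) ∧
    ∀ A : ℕ → OmegaOne → Set ℕ, IsGapMatrix T A →
      (∀ X : Set ℕ, X ≠ ∅ → X ≠ Set.univ → IsGapIn (columnUnion A X) T) ∧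
      (∀ X Y : Set ℕ, X ≠ ∅ → X ≠ Set.univ → Y ≠ ∅ → Y ≠ Set.univ →
        X ≠ Y → Y ≠ Xᶜ →
          ¬ Cohomologous T (columnUnion A X) (columnUnion A Y)) := by
  obtain ⟨A, hA⟩ := hT.exists_isGapMatrix
  refine ⟨hT.continuum_le_mk_gapCohomology hA, ⟨A, hA⟩, fun A hA =>
    ⟨fun X hX hX' => hA.isGapIn_columnUnion hX hX', fun X Y _ _ _ _ hXY hXY' hcoh => hcoh ?_⟩⟩
  simp only [hA.columnUnion_symmDiff]
  exact hA.isGapIn_columnUnion_symmDiff hXY hXY'
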